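/- Two players repeatedly play a zero-sum matrix game for $T \ge 1$ rounds. Player 1 has $d_1$ actions and Player 2 has $d_2$ actions. Write $\Delta_d$ for the probability simplex in $\mathbb{R}^d$, $\Delta_{d,\delta} = \{z \in \Delta_d : z_i \ge \delta \text{ for all } i\}$, and $R_d(z) = \sum_{i=1}^d z_i \ln z_i + \ln d$. **Adaptive adversary.** In round $t$ the adversary chooses a payoff matrix $A_t \in [-1,1]^{d_1\times d_2}$, which may depend on the actions sampled by both players in rounds $1,\dots,t-1$ (but not on those of round $t$). **Algorithm (Bandit-OMG-RFTL).** The inputs are $\eta > 0$, $0 < \delta < \min\{1/d_1, 1/d_2\}$ and arbitrary $x_1 \in \Delta_{d_1,\delta}$, $y_1 \in \Delta_{d_2,\delta}$. In round $t$ the actions $i_t \sim x_t$ and $j_t \sim y_t$ are sampled independently, given the past, and the players observe $i_t$, $j_t$ and the single number $(A_t)_{i_t j_t}$. Let $\hat A_t$ be the $d_1\times d_2$ matrix whose $(i_t,j_t)$ entry is $(A_t)_{i_t j_t} / (x_t(i_t)\, y_t(j_t))$ and whose other entries are $0$, and put $$\mathcal{L}_t(x,y) = x^\top \hat A_t y +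 \tfrac1\eta R_{d_1}(x) - \tfrac1\eta R_{d_2}(y).$$ The next strategies are $$x_{t+1} \in \arg\min_{x\in\Delta_{d_1,\delta}} \max_{y\in\Delta_{d_2,\delta}} \sum_{\tau=1}^t \mathcal{L}_\tau(x,y), \qquad y_{t+1} \in \arg\max_{y\in\Delta_{d_2,\delta}} \min_{x\in\Delta_{d_1,\delta}} \sum_{\tau=1}^t \mathcal{L}_\tau(x,y).$$ **Theorem.** There is an absolute constant $C$ such that, for all positive integers $d_1, d_2, T$ for which $\delta = T^{-1/6}$ satisfies $\delta < \min\{1/d_1,1/d_2\}$, for $\eta = T^{1/6}$, for all initial strategies $x_1, y_1$ as above and for every adaptive adversary, $$\left| \mathbb{E}\left[ \sum_{t=1}^T (A_t)_{i_t j_t} - \min_{x\in\Delta_{d_1}} \max_{y\in\Delta_{d_2}} \sum_{t=1}^T x^\top A_t y \right] \right| \le C\,(d_1+d_2)\,\ln(T)\,T^{5/6},$$ where the expectation is over the players' sampling. -/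

import Mathlib

open scoped Matrix

noncomputable section

namespace BanditOMG

/-- The restricted simplex `Δ_θ`: probability vectors all of whose entries are at least `θ`. -/
def restrictedSimplex (d : ℕ) (θ : ℝ) : Set (Fin d → ℝ) :=
  {z | z ∈ stdSimplex ℝ (Fin d) ∧ ∀ i, θ ≤ z i}

/-- The shifted negative entropy `R(z) = ∑ z_i ln z_i + ln d`. -/
def entropyReg {d : ℕ} (z : Fin d → ℝ) : ℝ :=
  ∑ i, z i * Real.log (z i) + Real.log d

/-- The expected payoff `xᵀ M y` of mixed strategies `x`, `y` in the matrix game `M`. -/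
def payoff {d₁ d₂ : ℕ} (M : Matrix (Fin d₁) (Fin d₂) ℝ) (x : Fin d₁ → ℝ) (y : Fin d₂ → ℝ) : ℝ :=
  x ⬝ᵥ (M *ᵥ y)

/-- The value `min_{x ∈ Δ} max_{y ∈ Δ} xᵀ M y` over the full simplices. -/
def gameValue {d₁ d₂ : ℕ} (M : Matrix (Fin d₁) (Fin d₂) ℝ) : ℝ :=
  sInf ((fun x => sSup ((fun y => payoff M x y) '' stdSimplex ℝ (Fin d₂))) ''
    stdSimplex ℝ (Fin d₁))

/-- `x ∈ argmin_{x ∈ X} max_{y ∈ Y} F x y`. -/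
def IsArgMinMax {α β : Type*} (X : Set α) (Y : Set β) (F : α → β → ℝ) (x : α) : Prop :=
  x ∈ X ∧ IsMinOn (fun a => sSup ((fun b => F a b) '' Y)) X x

/-- `y ∈ argmax_{y ∈ Y} min_{x ∈ X} F x y`. -/
def IsArgMaxMin {α β : Type*} (X : Set α) (Y : Set β) (F : α → β → ℝ) (y : β) : Prop :=
  y ∈ Y ∧ IsMaxOn (fun b => sInf ((fun a => F a b) '' X)) Y y

/-- What both players learn in one round under bandit feedback: the two sampled actions and the
single payoff entry that these actions select. -/
abbrev Obs (d₁ d₂ : ℕ) : Type := Fin d₁ × Fin d₂ × ℝ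

/-- The sampled actions of the past rounds, the MOST RECENT round first. -/
abbrev History (d₁ d₂ : ℕ) : Type := List (Fin d₁ × Fin d₂)

/-- The one-point importance-weighted estimate of a payoff matrix: the entry at the sampled
actions is the observed payoff divided by its sampling probability, all other entries are `0`. -/
def estimate {d₁ d₂ : ℕ} (x : Fin d₁ → ℝ) (y : Fin d₂ → ℝ) (o : Obs d₁ d₂) :
    Matrix (Fin d₁) (Fin d₂) ℝ :=
  Matrix.single o.1 o.2.1 (o.2.2 / (x o.1 * y o.2.1))

/-- The cumulative regularised objective `∑_τ (aᵀ Â_τ b + R_X(a) / η - R_Y(b) / η)` over the past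
rounds. Observations are listed with the most recent round first, so `x os`, `y os` are the
strategies from which the actions in the observation following `os` were sampled. -/
def cumObjective {d₁ d₂ : ℕ} (η : ℝ) (x : List (Obs d₁ d₂) → Fin d₁ → ℝ)
    (y : List (Obs d₁ d₂) → Fin d₂ → ℝ) :
    List (Obs d₁ d₂) → (Fin d₁ → ℝ) → (Fin d₂ → ℝ) → ℝ
  | [], _, _ => 0
  | o :: os, a, b =>
      cumObjective η x y os a b +
        (payoff (estimate (x os) (y os) o) a b
          + (1 / η) * entropyReg a - (1 / η) * entropyReg b)

/-- `x`, `y` are the strategies of the two players, as functions of the observations made so far,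
under Bandit-OMG-RFTL with parameters `δ`, `η`: the first pair is an arbitrary point of the
restricted simplices, and every later pair solves the regularised game built from the estimates of
all past rounds. -/
structure IsBanditOMGRFTL {d₁ d₂ : ℕ} (δ η : ℝ) (x : List (Obs d₁ d₂) → Fin d₁ → ℝ)
    (y : List (Obs d₁ d₂) → Fin d₂ → ℝ) : Prop where
  init_x : x [] ∈ restrictedSimplex d₁ δ
  init_y : y [] ∈ restrictedSimplex d₂ δ
  step_x : ∀ o os, IsArgMinMax (restrictedSimplex d₁ δ) (restrictedSimplex d₂ δ)
    (cumObjective η x y (o :: os)) (x (o :: os))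
  step_y : ∀ o os, IsArgMaxMin (restrictedSimplex d₁ δ) (restrictedSimplex d₂ δ)
    (cumObjective η x y (o :: os)) (y (o :: os))

/-- An adaptive adversary picks the payoff matrix of the coming round as a function of the actions
that the players sampled in all earlier rounds. -/
abbrev Adversary (d₁ d₂ : ℕ) : Type := History d₁ d₂ → Matrix (Fin d₁) (Fin d₂) ℝ

/-- The observations produced by a history of actions against the adversary `A`. -/
def transcript {d₁ d₂ : ℕ} (A : Adversary d₁ d₂) : History d₁ d₂ → List (Obs d₁ d₂)
  | [] => []
  | p :: h => (p.1, p.2, A h p.1 p.2) :: transcript A h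

/-- The probability of a history when in every round the two actions are sampled independently
from the current strategies of the two players. -/
def histProb {d₁ d₂ : ℕ} (x : List (Obs d₁ d₂) → Fin d₁ → ℝ) (y : List (Obs d₁ d₂) → Fin d₂ → ℝ)
    (A : Adversary d₁ d₂) : History d₁ d₂ → ℝ
  | [] => 1
  | p :: h => histProb x y A h * (x (transcript A h) p.1 * y (transcript A h) p.2)

/-- The expectation of `f`(history of the first `T` rounds) over the players' sampling. -/
def expectation {d₁ d₂ : ℕ} (x : List (Obs d₁ d₂) → Fin d₁ → ℝ)
    (y : List (Obs d₁ d₂) → Fin d₂ → ℝ) (A : Adversary d₁ d₂) (T : ℕ)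
    (f : History d₁ d₂ → ℝ) : ℝ :=
  ∑ ω : Fin T → Fin d₁ × Fin d₂, histProb x y A (List.ofFn ω) * f (List.ofFn ω)

/-- The realised total payoff `∑_t e_{x,t}ᵀ A_t e_{y,t}` along a history. -/
def totalPayoff {d₁ d₂ : ℕ} (A : Adversary d₁ d₂) : History d₁ d₂ → ℝ
  | [] => 0
  | p :: h => totalPayoff A h + A h p.1 p.2

/-- The sum `∑_t A_t` of the payoff matrices played along a history. -/
def matrixSum {d₁ d₂ : ℕ} (A : Adversary d₁ d₂) : History d₁ d₂ → Matrix (Fin d₁) (Fin d₂) ℝ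
  | [] => 0
  | _ :: h => matrixSum A h + A h

end BanditOMG

end

open scoped Matrix

noncomputable section

namespace BanditOMG

/-! ### The entropy regulariser -/

/-! The proof follows the value V_t of the regularised game built from the first t estimates, over
the restricted simplices; `x` and `y` form its saddle point. Passing from V_t to V_{t+1} adds one
regularised round. By the saddle inequalities the change is that round's objective at the old saddle
point, up to the distance the saddle point moves. The accumulated entropy has weight t/η, so strong
convexity makes this movement O(η/t), and the errors sum to a harmonic number
(`abs_regGame_value_sub_le`). At the sampling strategies the importance weights cancel exactly, so
V_T tracks the realised payoff on every history, with no averaging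
(`abs_regGame_sub_totalPayoff_le`). V_T is also close to the value of ∑ A_t: the entropies cost
O(T(d₁+d₂)/η), the restriction costs O(Tδ(d₁+d₂)), and the estimates cost the largest entry of ∑
(Â_t - A_t) (`abs_gameValue_sub_regGame_le`). That sum is a martingale even against an adaptive
adversary, with second moment at most T/δ² per entry (`expectation_estimateError_sq_le`). With u =
T^(1/6), δ = 1/u and η = u, all errors are O((d₁+d₂) u⁵ log T). -/

theorem mul_log_midpoint {a b : ℝ} (ha : a ∈ Set.Icc (0 : ℝ) 1) (hb : b ∈ Set.Icc (0 : ℝ) 1) :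
    (a + b) / 2 * Real.log ((a + b) / 2) + (a - b) ^ 2 / 8
      ≤ (a * Real.log a + b * Real.log b) / 2 := by
  -- The second derivative 1/t of t log t is at least 1 on (0, 1], so t²/2 can be subtracted without
  -- losing convexity. Midpoint convexity of the difference gives the quadratic gain.
  have hconv : ConvexOn ℝ (Set.Icc (0 : ℝ) 1) (fun t => t * Real.log t - t ^ 2 / 2) := by
    have hd : ∀ t ∈ Set.Ioo (0 : ℝ) 1,
        HasDerivAt (fun t : ℝ => t * Real.log t - t ^ 2 / 2) (Real.log t + 1 - t) t := by
      intro t ht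
      have h1 := Real.hasDerivAt_mul_log ht.1.ne'
      have h2 : HasDerivAt (fun t : ℝ => t ^ 2 / 2) t t := by
        have := (hasDerivAt_pow 2 t).div_const 2
        convert! this using 1
        simp
      exact h1.sub h2
    refine MonotoneOn.convexOn_of_deriv (convex_Icc 0 1) ?_ ?_ ?_
    · exact (Real.continuous_mul_log.sub (by fun_prop)).continuousOn
    · rw [interior_Icc]
      exact fun t ht => (hd t ht).differentiableAt.differentiableWithinAt
    · rw [interior_Icc]
      intro s hs t ht hst
      rw [(hd s hs).deriv, (hd t ht).deriv]
      have h1 : Real.log (s / t) ≤ s / t - 1 := Real.log_le_sub_one_of_pos (div_pos hs.1 ht.1)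
      rw [Real.log_div hs.1.ne' ht.1.ne'] at h1
      have h2 : s / t - 1 ≤ s - t := by
        rw [div_sub_one ht.1.ne', div_le_iff₀ ht.1]
        nlinarith [ht.2, hs.1, ht.1]
      linarith
  have h := hconv.2 ha hb (by norm_num : (0 : ℝ) ≤ 1 / 2) (by norm_num : (0 : ℝ) ≤ 1 / 2)
    (by norm_num)
  simp only [smul_eq_mul] at h
  have e : 1 / 2 * a + 1 / 2 * b = (a + b) / 2 := by ring
  rw [e] at h
  nlinarith [h]

/-- The floor δ bounds the derivative log t + 1, through 1 - 1/t ≤ log t ≤ 0. The crude constant 1/δ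
is harmless: the final choice of parameters makes 1/(ηδ) at most 1/δ². -/
theorem abs_mul_log_sub_le {δ a b : ℝ} (hδ : 0 < δ) (ha : a ∈ Set.Icc δ 1)
    (hb : b ∈ Set.Icc δ 1) :
    |a * Real.log a - b * Real.log b| ≤ 1 / δ * |a - b| := by
  have key : ∀ {a b : ℝ}, a ∈ Set.Icc δ 1 → b ∈ Set.Icc δ 1 →
      a * Real.log a - b * Real.log b ≤ 1 / δ * |a - b| := by
    intro a b ha hb
    have ha0 : 0 < a := hδ.trans_le ha.1
    have hb0 : 0 < b := hδ.trans_le hb.1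
    have h1 : b * (Real.log a - Real.log b) ≤ a - b := by
      have h := Real.log_le_sub_one_of_pos (div_pos ha0 hb0)
      rw [Real.log_div ha0.ne' hb0.ne'] at h
      have := mul_le_mul_of_nonneg_left h hb0.le
      rwa [mul_sub b (a / b), mul_div_cancel₀ a hb0.ne', mul_one] at this
    have h2 : |Real.log a + 1| ≤ 1 / δ := by
      have h3 : 1 ≤ 1 / δ := by rw [le_div_iff₀ hδ]; linarith [ha.1, ha.2]
      have h4 : Real.log a ≤ 0 := Real.log_nonpos ha0.le ha.2
      have h5 : 1 - a⁻¹ ≤ Real.log a := Real.one_sub_inv_le_log_of_pos ha0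
      have h6 : a⁻¹ ≤ 1 / δ := by rw [one_div]; exact inv_anti₀ hδ ha.1
      rw [abs_le]; constructor <;> linarith
    calc a * Real.log a - b * Real.log b ≤ (Real.log a + 1) * (a - b) := by nlinarith
      _ ≤ |(Real.log a + 1) * (a - b)| := le_abs_self _
      _ = |Real.log a + 1| * |a - b| := abs_mul _ _
      _ ≤ 1 / δ * |a - b| := by gcongr
  rw [abs_le]
  have h := key hb ha
  rw [abs_sub_comm] at h
  exact ⟨by linarith, key ha hb⟩

theorem mem_Icc_of_mem_stdSimplex {d : ℕ} {z : Fin d → ℝ} (hz : z ∈ stdSimplex ℝ (Fin d))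
    (i : Fin d) : z i ∈ Set.Icc (0 : ℝ) 1 :=
  ⟨hz.1 i, hz.2 ▸ Finset.single_le_sum (fun j _ => hz.1 j) (Finset.mem_univ i)⟩

theorem sum_abs_of_mem_stdSimplex {d : ℕ} {z : Fin d → ℝ} (hz : z ∈ stdSimplex ℝ (Fin d)) :
    ∑ i, |z i| = 1 := by
  rw [← hz.2]
  exact Finset.sum_congr rfl fun i _ => abs_of_nonneg (hz.1 i)

/-- Sum s - 1 ≤ s log s at s = d z_i. -/
theorem entropyReg_nonneg {d : ℕ} {z : Fin d → ℝ} (hz : z ∈ stdSimplex ℝ (Fin d)) :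
    0 ≤ entropyReg z := by
  have hd : 0 < d := by
    rcases Nat.eq_zero_or_pos d with rfl | h
    · simpa using hz.2
    · exact h
  have hd' : (0 : ℝ) < d := by exact_mod_cast hd
  have h : ∀ i, z i - 1 / d ≤ z i * Real.log (z i) + z i * Real.log d := by
    intro i
    rcases (hz.1 i).eq_or_lt with h0 | h0
    · rw [← h0]; simp
    · have h1 := Real.self_sub_one_le_mul_log (mul_nonneg hd'.le h0.le)
      rw [Real.log_mul hd'.ne' h0.ne'] at h1
      have h2 := mul_le_mul_of_nonneg_left h1 (by positivity : (0 : ℝ) ≤ 1 / d)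
      have e1 : 1 / (d : ℝ) * (d * z i - 1) = z i - 1 / d := by field_simp
      have e2 : 1 / (d : ℝ) * (d * z i * (Real.log d + Real.log (z i)))
          = z i * Real.log (z i) + z i * Real.log d := by field_simp; ring
      rwa [e1, e2] at h2
  have hs := Finset.sum_le_sum fun i (_ : i ∈ Finset.univ) => h i
  rw [Finset.sum_sub_distrib, Finset.sum_add_distrib, ← Finset.sum_mul, hz.2] at hs
  simp only [Finset.sum_const, Finset.card_univ, Fintype.card_fin, nsmul_eq_mul, one_mul] at hs
  rw [mul_one_div_cancel hd'.ne'] at hs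
  unfold entropyReg
  linarith

theorem entropyReg_le {d : ℕ} {z : Fin d → ℝ} (hz : z ∈ stdSimplex ℝ (Fin d)) :
    entropyReg z ≤ d := by
  have h : ∑ i, z i * Real.log (z i) ≤ 0 :=
    Finset.sum_nonpos fun i _ =>
      Real.mul_log_nonpos (hz.1 i) (mem_Icc_of_mem_stdSimplex hz i).2
  have := Real.log_le_self (Nat.cast_nonneg (α := ℝ) d)
  unfold entropyReg
  linarith

theorem entropyReg_midpoint {d : ℕ} {z w : Fin d → ℝ} (hz : z ∈ stdSimplex ℝ (Fin d))
    (hw : w ∈ stdSimplex ℝ (Fin d)) :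
    entropyReg ((1 / 2 : ℝ) • z + (1 / 2 : ℝ) • w) + (∑ i, (z i - w i) ^ 2) / 8
      ≤ (entropyReg z + entropyReg w) / 2 := by
  have h := Finset.sum_le_sum fun i (_ : i ∈ Finset.univ) =>
    mul_log_midpoint (mem_Icc_of_mem_stdSimplex hz i) (mem_Icc_of_mem_stdSimplex hw i)
  rw [Finset.sum_add_distrib, ← Finset.sum_div, ← Finset.sum_div, Finset.sum_add_distrib] at h
  have e : ∀ i, ((1 / 2 : ℝ) • z + (1 / 2 : ℝ) • w) i = (z i + w i) / 2 := by
    intro i; simp; ring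
  simp only [entropyReg, e]
  linarith

theorem convexOn_entropyReg (d : ℕ) :
    ConvexOn ℝ (stdSimplex ℝ (Fin d)) (entropyReg (d := d)) := by
  refine ⟨convex_stdSimplex ℝ _, fun z hz w hw s t hs ht hst => ?_⟩
  have h := Finset.sum_le_sum fun i (_ : i ∈ Finset.univ) =>
    Real.convexOn_mul_log.2 (hz.1 i : z i ∈ Set.Ici (0 : ℝ)) (hw.1 i : w i ∈ Set.Ici (0 : ℝ))
      hs ht hst
  simp only [smul_eq_mul, Finset.sum_add_distrib, ← Finset.mul_sum] at h
  simp only [entropyReg, Pi.add_apply, Pi.smul_apply, smul_eq_mul]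
  have e : s * Real.log d + t * Real.log d = Real.log d := by rw [← add_mul, hst, one_mul]
  linarith

theorem continuous_entropyReg (d : ℕ) : Continuous (entropyReg (d := d)) := by
  unfold entropyReg
  refine (continuous_finsetSum _ fun i _ => ?_).add continuous_const
  exact Real.continuous_mul_log.comp (continuous_apply i)

/-! ### The restricted simplex -/

theorem restrictedSimplex_mem_Icc {d : ℕ} {δ : ℝ} {z : Fin d → ℝ} (hz : z ∈ restrictedSimplex d δ)
    (i : Fin d) : z i ∈ Set.Icc δ 1 :=
  ⟨hz.2 i, (mem_Icc_of_mem_stdSimplex hz.1 i).2⟩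

theorem abs_entropyReg_sub_le {d : ℕ} {δ : ℝ} (hδ : 0 < δ) {z w : Fin d → ℝ}
    (hz : z ∈ restrictedSimplex d δ) (hw : w ∈ restrictedSimplex d δ) :
    |entropyReg z - entropyReg w| ≤ 1 / δ * ∑ i, |z i - w i| := by
  have e : entropyReg z - entropyReg w
      = ∑ i, (z i * Real.log (z i) - w i * Real.log (w i)) := by
    rw [Finset.sum_sub_distrib]; unfold entropyReg; ring
  rw [e, Finset.mul_sum]
  exact (Finset.abs_sum_le_sum_abs _ _).trans (Finset.sum_le_sum fun i _ =>
    abs_mul_log_sub_le hδ (restrictedSimplex_mem_Icc hz i) (restrictedSimplex_mem_Icc hw i))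

theorem convex_restrictedSimplex (d : ℕ) (δ : ℝ) : Convex ℝ (restrictedSimplex d δ) := by
  intro z hz w hw s t hs ht hst
  refine ⟨convex_stdSimplex ℝ _ hz.1 hw.1 hs ht hst, fun i => ?_⟩
  simp only [Pi.add_apply, Pi.smul_apply, smul_eq_mul]
  calc δ = s * δ + t * δ := by rw [← add_mul, hst, one_mul]
    _ ≤ _ := by gcongr; exacts [hz.2 i, hw.2 i]

theorem isCompact_restrictedSimplex (d : ℕ) (δ : ℝ) : IsCompact (restrictedSimplex d δ) := by
  have : restrictedSimplex d δ = stdSimplex ℝ (Fin d) ∩ ⋂ i, {z | δ ≤ z i} := by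
    ext z; simp [restrictedSimplex]
  rw [this]
  exact (isCompact_stdSimplex _ _).inter_right
    (isClosed_iInter fun i => isClosed_le continuous_const (continuous_apply i))

/-- Mixing with the uniform distribution moves the simplex into the restricted simplex. -/
theorem exists_restrictedSimplex_near {d : ℕ} {δ : ℝ} (hδ : 0 ≤ δ) (hd : δ * d ≤ 1)
    {z : Fin d → ℝ} (hz : z ∈ stdSimplex ℝ (Fin d)) :
    ∃ w ∈ restrictedSimplex d δ, ∑ i, |z i - w i| ≤ 2 * (δ * d) := by
  have hnn : ∀ i, 0 ≤ (1 - δ * d) * z i := fun i => mul_nonneg (by linarith) (hz.1 i)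
  refine ⟨fun i => (1 - δ * d) * z i + δ, ⟨⟨fun i => by linarith [hnn i], ?_⟩,
    fun i => by linarith [hnn i]⟩, ?_⟩
  · rw [Finset.sum_add_distrib, ← Finset.mul_sum, hz.2]
    simp; ring
  · have h : ∀ i, |z i - ((1 - δ * d) * z i + δ)| ≤ δ * d * z i + δ := by
      intro i
      have := mul_nonneg (mul_nonneg hδ d.cast_nonneg) (hz.1 i)
      rw [abs_le]; constructor <;> nlinarith
    refine (Finset.sum_le_sum fun i _ => h i).trans (le_of_eq ?_)
    rw [Finset.sum_add_distrib, ← Finset.mul_sum, hz.2]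
    simp; ring

/-! ### The payoff -/

section Payoff

variable {d₁ d₂ : ℕ}

theorem payoff_eq_sum (M : Matrix (Fin d₁) (Fin d₂) ℝ) (x : Fin d₁ → ℝ) (y : Fin d₂ → ℝ) :
    payoff M x y = ∑ i, ∑ j, x i * (M i j * y j) := by
  simp [payoff, dotProduct, Matrix.mulVec, Finset.mul_sum]

theorem payoff_zero (x : Fin d₁ → ℝ) (y : Fin d₂ → ℝ) : payoff 0 x y = 0 := by
  simp [payoff]

theorem payoff_add (M N : Matrix (Fin d₁) (Fin d₂) ℝ) (x : Fin d₁ → ℝ) (y : Fin d₂ → ℝ) :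
    payoff (M + N) x y = payoff M x y + payoff N x y := by
  simp [payoff, Matrix.add_mulVec]

theorem payoff_sub (M N : Matrix (Fin d₁) (Fin d₂) ℝ) (x : Fin d₁ → ℝ) (y : Fin d₂ → ℝ) :
    payoff (M - N) x y = payoff M x y - payoff N x y := by
  simp [payoff, Matrix.sub_mulVec]

theorem payoff_combo_left (M : Matrix (Fin d₁) (Fin d₂) ℝ) (s t : ℝ) (x x' : Fin d₁ → ℝ)
    (y : Fin d₂ → ℝ) :
    payoff M (s • x + t • x') y = s * payoff M x y + t * payoff M x' y := by
  simp [payoff]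

theorem payoff_combo_right (M : Matrix (Fin d₁) (Fin d₂) ℝ) (s t : ℝ) (x : Fin d₁ → ℝ)
    (y y' : Fin d₂ → ℝ) :
    payoff M x (s • y + t • y') = s * payoff M x y + t * payoff M x y' := by
  simp [payoff, Matrix.mulVec_add, Matrix.mulVec_smul]

theorem payoff_sub_left (M : Matrix (Fin d₁) (Fin d₂) ℝ) (x x' : Fin d₁ → ℝ) (y : Fin d₂ → ℝ) :
    payoff M (x - x') y = payoff M x y - payoff M x' y := by
  simp [payoff]

theorem payoff_sub_right (M : Matrix (Fin d₁) (Fin d₂) ℝ) (x : Fin d₁ → ℝ) (y y' : Fin d₂ → ℝ) :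
    payoff M x (y - y') = payoff M x y - payoff M x y' := by
  simp [payoff, Matrix.mulVec_sub]

theorem abs_payoff_le {M : Matrix (Fin d₁) (Fin d₂) ℝ} {B : ℝ} (hM : ∀ i j, |M i j| ≤ B)
    (x : Fin d₁ → ℝ) (y : Fin d₂ → ℝ) :
    |payoff M x y| ≤ B * ((∑ i, |x i|) * ∑ j, |y j|) := by
  rw [payoff_eq_sum, Finset.sum_mul_sum, Finset.mul_sum]
  refine (Finset.abs_sum_le_sum_abs _ _).trans (Finset.sum_le_sum fun i _ => ?_)
  rw [Finset.mul_sum]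
  refine (Finset.abs_sum_le_sum_abs _ _).trans (Finset.sum_le_sum fun j _ => ?_)
  rw [abs_mul, abs_mul]
  calc |x i| * (|M i j| * |y j|) ≤ |x i| * (B * |y j|) := by gcongr; exact hM i j
    _ = _ := by ring

theorem abs_payoff_sub_left_le {M : Matrix (Fin d₁) (Fin d₂) ℝ} {B : ℝ}
    (hM : ∀ i j, |M i j| ≤ B) (x x' : Fin d₁ → ℝ) {y : Fin d₂ → ℝ}
    (hy : y ∈ stdSimplex ℝ (Fin d₂)) :
    |payoff M x y - payoff M x' y| ≤ B * ∑ i, |x i - x' i| := by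
  have h := abs_payoff_le hM (x - x') y
  rwa [payoff_sub_left, sum_abs_of_mem_stdSimplex hy, mul_one] at h

theorem abs_payoff_sub_right_le {M : Matrix (Fin d₁) (Fin d₂) ℝ} {B : ℝ}
    (hM : ∀ i j, |M i j| ≤ B) {x : Fin d₁ → ℝ} (hx : x ∈ stdSimplex ℝ (Fin d₁))
    (y y' : Fin d₂ → ℝ) :
    |payoff M x y - payoff M x y'| ≤ B * ∑ j, |y j - y' j| := by
  have h := abs_payoff_le hM x (y - y')
  rwa [payoff_sub_right, sum_abs_of_mem_stdSimplex hx, one_mul] at h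

theorem continuous_payoff_right (M : Matrix (Fin d₁) (Fin d₂) ℝ) (x : Fin d₁ → ℝ) :
    Continuous fun y => payoff M x y := by
  simp only [payoff_eq_sum]; fun_prop

theorem continuous_payoff (M : Matrix (Fin d₁) (Fin d₂) ℝ) :
    Continuous fun z : (Fin d₁ → ℝ) × (Fin d₂ → ℝ) => payoff M z.1 z.2 := by
  simp only [payoff_eq_sum]; fun_prop

end Payoff

/-! ### Saddle points of regularised matrix games -/

section RegularisedGame

variable {d₁ d₂ : ℕ}

/-- The matrix game `M` regularised with weight `c`. -/
def regGame (M : Matrix (Fin d₁) (Fin d₂) ℝ) (c : ℝ) (a : Fin d₁ → ℝ) (b : Fin d₂ → ℝ) : ℝ :=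
  payoff M a b + c * (entropyReg a - entropyReg b)

theorem continuous_regGame (M : Matrix (Fin d₁) (Fin d₂) ℝ) (c : ℝ) :
    Continuous fun z : (Fin d₁ → ℝ) × (Fin d₂ → ℝ) => regGame M c z.1 z.2 :=
  (continuous_payoff M).add (continuous_const.mul
    (((continuous_entropyReg d₁).comp continuous_fst).sub
      ((continuous_entropyReg d₂).comp continuous_snd)))

theorem convexOn_regGame (M : Matrix (Fin d₁) (Fin d₂) ℝ) {c : ℝ} (hc : 0 ≤ c)
    (b : Fin d₂ → ℝ) : ConvexOn ℝ (stdSimplex ℝ (Fin d₁)) fun a => regGame M c a b := by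
  refine ⟨convex_stdSimplex ℝ _, fun x hx y hy s t hs ht hst => ?_⟩
  have h := mul_le_mul_of_nonneg_left ((convexOn_entropyReg d₁).2 hx hy hs ht hst) hc
  simp only [regGame, payoff_combo_left, smul_eq_mul] at h ⊢
  obtain rfl : t = 1 - s := by linarith
  nlinarith [h]

theorem concaveOn_regGame (M : Matrix (Fin d₁) (Fin d₂) ℝ) {c : ℝ} (hc : 0 ≤ c)
    (a : Fin d₁ → ℝ) : ConcaveOn ℝ (stdSimplex ℝ (Fin d₂)) fun b => regGame M c a b := by
  refine ⟨convex_stdSimplex ℝ _, fun x hx y hy s t hs ht hst => ?_⟩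
  have h := mul_le_mul_of_nonneg_left ((convexOn_entropyReg d₂).2 hx hy hs ht hst) hc
  simp only [regGame, payoff_combo_right, smul_eq_mul] at h ⊢
  obtain rfl : t = 1 - s := by linarith
  nlinarith [h]

theorem regGame_add (M N : Matrix (Fin d₁) (Fin d₂) ℝ) (c s : ℝ) (a : Fin d₁ → ℝ)
    (b : Fin d₂ → ℝ) : regGame (M + N) (c + s) a b = regGame M c a b + regGame N s a b := by
  simp only [regGame, payoff_add]; ring

/-- A min-max strategy and a max-min strategy of a convex-concave game on compact sets form a
saddle point. -/
theorem isSaddlePointOn_of_isArgMinMax {E F : Type*} [NormedAddCommGroup E] [NormedSpace ℝ E]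
    [NormedAddCommGroup F] [NormedSpace ℝ F] {X : Set E} {Y : Set F} {f : E → F → ℝ}
    (hX : IsCompact X) (hY : IsCompact Y) (hf : Continuous fun z : E × F => f z.1 z.2)
    (hfX : ∀ y ∈ Y, ConvexOn ℝ X fun x => f x y) (hfY : ∀ x ∈ X, ConcaveOn ℝ Y fun y => f x y)
    {x : E} {y : F} (hx : IsArgMinMax X Y f x) (hy : IsArgMaxMin X Y f y) :
    IsSaddlePointOn X Y f x y := by
  have hcX : ∀ y, Continuous fun x => f x y := fun y => hf.comp (by fun_prop : Continuous (·, y))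
  have hcY : ∀ x, Continuous fun y => f x y := fun x => hf.comp (by fun_prop : Continuous (x, ·))
  -- Sion's theorem gives some saddle point (a, b). Optimality of x and y then shows that each
  -- guarantees the value f a b, which makes (x, y) a saddle point too.
  obtain ⟨a, ha, b, hb, hab⟩ := Sion.exists_isSaddlePointOn ⟨x, hx.1⟩ (hfX y hy.1).1 hX
    (fun y _ => (hcX y).lowerSemicontinuous.lowerSemicontinuousOn X)
    (fun y h => (hfX y h).quasiconvexOn) (hfY x hx.1).1 ⟨y, hy.1⟩ hY
    (fun x _ => (hcY x).upperSemicontinuous.upperSemicontinuousOn Y)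
    (fun x h => (hfY x h).quasiconcaveOn)
  intro x' hx' y' hy'
  have h1 : f x y' ≤ f a b := by
    have hle : sSup ((fun b => f x b) '' Y) ≤ sSup ((fun b => f a b) '' Y) := hx.2 ha
    refine (le_csSup (hY.image (hcY x)).bddAbove ⟨y', hy', rfl⟩).trans (hle.trans ?_)
    refine csSup_le ⟨_, b, hb, rfl⟩ ?_
    rintro _ ⟨y'', h, rfl⟩
    exact hab a ha y'' h
  have h2 : f a b ≤ f x' y := by
    have hle : sInf ((fun a => f a b) '' X) ≤ sInf ((fun a => f a y) '' X) := hy.2 hb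
    refine le_trans (le_trans ?_ hle) (csInf_le (hX.image (hcX y)).bddBelow ⟨x', hx', rfl⟩)
    refine le_csInf ⟨_, a, ha, rfl⟩ ?_
    rintro _ ⟨x'', h, rfl⟩
    exact hab x'' h b hb
  exact h1.trans h2

theorem isSaddlePointOn_regGame {δ c : ℝ} (hc : 0 ≤ c) (M : Matrix (Fin d₁) (Fin d₂) ℝ)
    {x : Fin d₁ → ℝ} {y : Fin d₂ → ℝ}
    (hx : IsArgMinMax (restrictedSimplex d₁ δ) (restrictedSimplex d₂ δ) (regGame M c) x)
    (hy : IsArgMaxMin (restrictedSimplex d₁ δ) (restrictedSimplex d₂ δ) (regGame M c) y) :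
    IsSaddlePointOn (restrictedSimplex d₁ δ) (restrictedSimplex d₂ δ) (regGame M c) x y :=
  isSaddlePointOn_of_isArgMinMax (isCompact_restrictedSimplex _ _)
    (isCompact_restrictedSimplex _ _) (continuous_regGame M c)
    (fun b _ => (convexOn_regGame M hc b).subset (fun _ h => h.1) (convex_restrictedSimplex _ _))
    (fun a _ => (concaveOn_regGame M hc a).subset (fun _ h => h.1) (convex_restrictedSimplex _ _))
    hx hy

/-- Quadratic growth of a regularised game around a saddle point, first player. -/
theorem regGame_growth_left {δ c : ℝ} (hc : 0 ≤ c) {M : Matrix (Fin d₁) (Fin d₂) ℝ}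
    {x a : Fin d₁ → ℝ} {y : Fin d₂ → ℝ} (hx : x ∈ restrictedSimplex d₁ δ)
    (ha : a ∈ restrictedSimplex d₁ δ) (hy : y ∈ restrictedSimplex d₂ δ)
    (h : IsSaddlePointOn (restrictedSimplex d₁ δ) (restrictedSimplex d₂ δ) (regGame M c) x y) :
    regGame M c x y + c / 4 * ∑ i, (a i - x i) ^ 2 ≤ regGame M c a y := by
  -- Testing the saddle point against the midpoint of a and x gains c/8 times the squared distance;
  -- solving for the value at a doubles this to c/4.
  have hm := h _ (convex_restrictedSimplex d₁ δ ha hx (by norm_num : (0 : ℝ) ≤ 1 / 2)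
    (by norm_num : (0 : ℝ) ≤ 1 / 2) (by norm_num)) y hy
  have he := mul_le_mul_of_nonneg_left (entropyReg_midpoint ha.1 hx.1) hc
  simp only [regGame, payoff_combo_left] at hm ⊢
  nlinarith [hm, he]

/-- Quadratic growth of a regularised game around a saddle point, second player. -/
theorem regGame_growth_right {δ c : ℝ} (hc : 0 ≤ c) {M : Matrix (Fin d₁) (Fin d₂) ℝ}
    {x : Fin d₁ → ℝ} {y b : Fin d₂ → ℝ} (hx : x ∈ restrictedSimplex d₁ δ)
    (hy : y ∈ restrictedSimplex d₂ δ) (hb : b ∈ restrictedSimplex d₂ δ)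
    (h : IsSaddlePointOn (restrictedSimplex d₁ δ) (restrictedSimplex d₂ δ) (regGame M c) x y) :
    regGame M c x b + c / 4 * ∑ i, (b i - y i) ^ 2 ≤ regGame M c x y := by
  have hm := h x hx _ (convex_restrictedSimplex d₂ δ hb hy (by norm_num : (0 : ℝ) ≤ 1 / 2)
    (by norm_num : (0 : ℝ) ≤ 1 / 2) (by norm_num))
  have he := mul_le_mul_of_nonneg_left (entropyReg_midpoint hb.1 hy.1) hc
  simp only [regGame, payoff_combo_right] at hm ⊢
  nlinarith [hm, he]

theorem abs_regGame_sub_left_le {δ B s : ℝ} (hδ : 0 < δ) (hs : 0 ≤ s)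
    {N : Matrix (Fin d₁) (Fin d₂) ℝ} (hN : ∀ i j, |N i j| ≤ B) {x x' : Fin d₁ → ℝ}
    {y : Fin d₂ → ℝ} (hx : x ∈ restrictedSimplex d₁ δ) (hx' : x' ∈ restrictedSimplex d₁ δ)
    (hy : y ∈ restrictedSimplex d₂ δ) :
    |regGame N s x y - regGame N s x' y| ≤ (B + s / δ) * ∑ i, |x i - x' i| := by
  have e : regGame N s x y - regGame N s x' y
      = (payoff N x y - payoff N x' y) + s * (entropyReg x - entropyReg x') := by
    simp only [regGame]; ring
  rw [e]
  refine (abs_add_le _ _).trans ?_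
  rw [abs_mul, abs_of_nonneg hs, add_mul]
  refine add_le_add (abs_payoff_sub_left_le hN x x' hy.1) ?_
  refine (mul_le_mul_of_nonneg_left (abs_entropyReg_sub_le hδ hx hx') hs).trans (le_of_eq ?_)
  ring

theorem abs_regGame_sub_right_le {δ B s : ℝ} (hδ : 0 < δ) (hs : 0 ≤ s)
    {N : Matrix (Fin d₁) (Fin d₂) ℝ} (hN : ∀ i j, |N i j| ≤ B) {x : Fin d₁ → ℝ}
    {y y' : Fin d₂ → ℝ} (hx : x ∈ restrictedSimplex d₁ δ) (hy : y ∈ restrictedSimplex d₂ δ)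
    (hy' : y' ∈ restrictedSimplex d₂ δ) :
    |regGame N s x y - regGame N s x y'| ≤ (B + s / δ) * ∑ i, |y i - y' i| := by
  have e : regGame N s x y - regGame N s x y'
      = (payoff N x y - payoff N x y') - s * (entropyReg y - entropyReg y') := by
    simp only [regGame]; ring
  rw [e]
  refine (abs_sub _ _).trans ?_
  rw [abs_mul, abs_of_nonneg hs, add_mul]
  refine add_le_add (abs_payoff_sub_right_le hN hx.1 y y') ?_
  refine (mul_le_mul_of_nonneg_left (abs_entropyReg_sub_le hδ hy hy') hs).trans (le_of_eq ?_)
  ring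

theorem sq_sum_abs_le {d : ℕ} (z w : Fin d → ℝ) :
    (∑ i, |z i - w i|) ^ 2 ≤ d * ∑ i, (z i - w i) ^ 2 := by
  have h := sq_sum_le_card_mul_sum_sq (s := Finset.univ) (f := fun i => |z i - w i|)
  simpa only [sq_abs, Finset.card_univ, Fintype.card_fin] using h

/-- Adding one regularised game `N` to a regularised game `M` changes the value by the payoff of
`N` at the old saddle point, up to a stability error. -/
theorem abs_regGame_value_sub_le {δ B c s : ℝ} (hδ : 0 < δ) (hB : 0 ≤ B) (hc : 0 ≤ c)
    (hs : 0 < s) {M N : Matrix (Fin d₁) (Fin d₂) ℝ} (hN : ∀ i j, |N i j| ≤ B)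
    {x x' : Fin d₁ → ℝ} {y y' : Fin d₂ → ℝ} (hx : x ∈ restrictedSimplex d₁ δ)
    (hx' : x' ∈ restrictedSimplex d₁ δ) (hy : y ∈ restrictedSimplex d₂ δ)
    (hy' : y' ∈ restrictedSimplex d₂ δ)
    (h : IsSaddlePointOn (restrictedSimplex d₁ δ) (restrictedSimplex d₂ δ) (regGame M c) x y)
    (h' : IsSaddlePointOn (restrictedSimplex d₁ δ) (restrictedSimplex d₂ δ)
      (regGame (M + N) (c + s)) x' y') :
    |regGame (M + N) (c + s) x' y' - regGame M c x y - regGame N s x y|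
      ≤ 8 * (d₁ + d₂) * (B + s / δ) ^ 2 / (c + s) := by
  have hcs : 0 < c + s := by linarith
  have hL : 0 ≤ B + s / δ := by positivity
  set L := B + s / δ
  have hp := sq_sum_abs_le x x'
  have hq := sq_sum_abs_le y y'
  have hp0 : 0 ≤ ∑ i, |x i - x' i| := Finset.sum_nonneg fun _ _ => abs_nonneg _
  have hq0 : 0 ≤ ∑ i, |y i - y' i| := Finset.sum_nonneg fun _ _ => abs_nonneg _
  have hP0 : 0 ≤ ∑ i, (x i - x' i) ^ 2 := Finset.sum_nonneg fun _ _ => sq_nonneg _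
  have hQ0 : 0 ≤ ∑ i, (y i - y' i) ^ 2 := Finset.sum_nonneg fun _ _ => sq_nonneg _
  have g1 := regGame_growth_left hcs.le hx' hx hy' h'
  have g2 := regGame_growth_right hcs.le hx' hy' hy h'
  have s1 := h x hx y' hy'
  have s2 := h x' hx' y hy
  have l1 := abs_regGame_sub_left_le hδ hs.le hN hx hx' hy'
  have l2 := abs_regGame_sub_right_le hδ hs.le hN hx' hy hy'
  have l3 := abs_regGame_sub_left_le hδ hs.le hN hx hx' hy
  have l4 := abs_regGame_sub_right_le hδ hs.le hN hx hy hy'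
  simp only [regGame_add] at g1 g2 ⊢
  rw [abs_le] at l1 l2 l3 l4
  set p := ∑ i, |x i - x' i|
  set q := ∑ i, |y i - y' i|
  set P := ∑ i, (x i - x' i) ^ 2
  set Q := ∑ i, (y i - y' i) ^ 2
  -- In the sum of the two growth bounds `g1` and `g2`, the `M` terms have the favourable sign by
  -- the old saddle inequalities `s1` and `s2`. Only the Lipschitz variation of `N` remains.
  have hPQ : (c + s) / 4 * (P + Q) ≤ L * (p + q) := by linarith [l1.2, l2.1]
  have hpq : (p + q) ^ 2 ≤ 2 * (d₁ + d₂) * (P + Q) := by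
    have h1 : 0 ≤ (d₁ : ℝ) * Q := by positivity
    have h2 : 0 ≤ (d₂ : ℝ) * P := by positivity
    nlinarith [sq_nonneg (p - q)]
  -- A quadratic quantity is bounded by a linear one, so dividing by p + q bounds the movement
  -- itself.
  have hmove : (p + q) * (c + s) ≤ 8 * (d₁ + d₂) * L := by
    rcases (add_nonneg hp0 hq0).eq_or_lt with h0 | h0
    · rw [← h0, zero_mul]; positivity
    · have h1 : (p + q) * ((p + q) * (c + s)) ≤ (p + q) * (8 * (d₁ + d₂) * L) := by
        have h2 := mul_le_mul_of_nonneg_right hpq hcs.le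
        have h3 := mul_le_mul_of_nonneg_left hPQ (by positivity : (0 : ℝ) ≤ 8 * (d₁ + d₂))
        nlinarith [h2, h3]
      exact le_of_mul_le_mul_left h1 h0
  have hfin : L * (p + q) ≤ 8 * (d₁ + d₂) * L ^ 2 / (c + s) := by
    rw [le_div_iff₀ hcs]
    nlinarith [mul_le_mul_of_nonneg_left hmove hL]
  -- The new value lies between the new game at (x', y) and at (x, y'). The old saddle inequalities
  -- compare their `M` parts with the old value, and their `N` parts are within L q or L p of `N` at
  -- (x, y).
  have u1 := h' x hx y' hy'
  have u2 := h' x' hx' y hy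
  simp only [regGame_add] at u1 u2
  have hLp : 0 ≤ L * p := by positivity
  have hLq : 0 ≤ L * q := by positivity
  have n1 : 0 ≤ (c + s) / 4 * P := by positivity
  have n2 : 0 ≤ (c + s) / 4 * Q := by positivity
  refine le_trans ?_ hfin
  rw [abs_le]
  constructor <;> linarith [l3.1, l3.2, l4.1, l4.2, l1.1, l2.1]

end RegularisedGame

section Play

variable {d₁ d₂ : ℕ} {δ η : ℝ} {x : List (Obs d₁ d₂) → Fin d₁ → ℝ}
  {y : List (Obs d₁ d₂) → Fin d₂ → ℝ} {A : Adversary d₁ d₂}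

/-! ### The strategies along a history -/

theorem IsBanditOMGRFTL.mem_x (hxy : IsBanditOMGRFTL δ η x y) :
    ∀ os, x os ∈ restrictedSimplex d₁ δ
  | [] => hxy.init_x
  | o :: os => (hxy.step_x o os).1

theorem IsBanditOMGRFTL.mem_y (hxy : IsBanditOMGRFTL δ η x y) :
    ∀ os, y os ∈ restrictedSimplex d₂ δ
  | [] => hxy.init_y
  | o :: os => (hxy.step_y o os).1

/-- The sum of the estimates of all past payoff matrices. -/
def estimateSum (x : List (Obs d₁ d₂) → Fin d₁ → ℝ) (y : List (Obs d₁ d₂) → Fin d₂ → ℝ) :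
    List (Obs d₁ d₂) → Matrix (Fin d₁) (Fin d₂) ℝ
  | [] => 0
  | o :: os => estimateSum x y os + estimate (x os) (y os) o

theorem cumObjective_eq_regGame (η : ℝ) (x : List (Obs d₁ d₂) → Fin d₁ → ℝ)
    (y : List (Obs d₁ d₂) → Fin d₂ → ℝ) (os : List (Obs d₁ d₂)) :
    cumObjective η x y os = regGame (estimateSum x y os) (os.length * (1 / η)) := by
  induction os with
  | nil => ext a b; simp [cumObjective, regGame, estimateSum, payoff_zero]
  | cons o os ih =>
    ext a b
    rw [cumObjective, ih, estimateSum, List.length_cons, Nat.cast_succ, add_mul, one_mul,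
      regGame_add, regGame, regGame]
    ring

theorem IsBanditOMGRFTL.isSaddlePointOn (hη : 0 < η) (hxy : IsBanditOMGRFTL δ η x y) :
    ∀ os : List (Obs d₁ d₂), IsSaddlePointOn (restrictedSimplex d₁ δ) (restrictedSimplex d₂ δ)
      (regGame (estimateSum x y os) (os.length * (1 / η))) (x os) (y os)
  -- Before the first round the game is identically 0, so the arbitrary initial pair is already a
  -- saddle point.
  | [] => fun a _ b _ => by simp [regGame, estimateSum, payoff_zero]
  | o :: os => by
    have hx := hxy.step_x o os
    have hy := hxy.step_y o os
    rw [cumObjective_eq_regGame] at hx hy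
    exact isSaddlePointOn_regGame (by positivity) _ hx hy

theorem length_transcript (A : Adversary d₁ d₂) (h : History d₁ d₂) :
    (transcript A h).length = h.length := by
  induction h with
  | nil => rfl
  | cons p h ih => simp [transcript, ih]

/-- The sampling probability cancels the importance weight on every outcome, not just in
expectation. This is what makes the comparison with the realised payoff pathwise. -/
theorem payoff_estimate {a : Fin d₁ → ℝ} {b : Fin d₂ → ℝ} {o : Obs d₁ d₂} (ha : a o.1 ≠ 0)
    (hb : b o.2.1 ≠ 0) : payoff (estimate a b o) a b = o.2.2 := by
  rw [payoff_eq_sum, Finset.sum_eq_single o.1, Finset.sum_eq_single o.2.1]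
  · simp only [estimate, Matrix.single_apply_same]
    field_simp
  · intro j _ hj
    simp [estimate, hj.symm]
  · simp
  · intro i _ hi
    simp [estimate, hi.symm]
  · simp

theorem abs_estimate_le (hδ : 0 < δ) {a : Fin d₁ → ℝ} {b : Fin d₂ → ℝ}
    (ha : a ∈ restrictedSimplex d₁ δ) (hb : b ∈ restrictedSimplex d₂ δ) {o : Obs d₁ d₂}
    (ho : |o.2.2| ≤ 1) (i : Fin d₁) (j : Fin d₂) : |estimate a b o i j| ≤ 1 / δ ^ 2 := by
  rw [estimate, Matrix.single_apply]
  split_ifs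
  · have h1 : δ ^ 2 ≤ a o.1 * b o.2.1 := by
      rw [sq]; exact mul_le_mul (ha.2 _) (hb.2 _) hδ.le (hδ.le.trans (ha.2 _))
    have h2 : 0 < a o.1 * b o.2.1 := (by positivity : 0 < δ ^ 2).trans_le h1
    rw [abs_div, abs_of_pos h2]
    exact div_le_div₀ zero_le_one ho (by positivity) h1
  · rw [abs_zero]; positivity

/-- Along every history, the value of the regularised game built from the estimates is close to
the realised total payoff. -/
theorem abs_regGame_sub_totalPayoff_le (hδ : 0 < δ) (hη : 0 < η)
    (hxy : IsBanditOMGRFTL δ η x y) (hA : ∀ h i j, |A h i j| ≤ 1) (h : History d₁ d₂) :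
    |regGame (estimateSum x y (transcript A h)) (h.length * (1 / η)) (x (transcript A h))
        (y (transcript A h)) - totalPayoff A h|
      ≤ 8 * (d₁ + d₂) * (1 / δ ^ 2 + 1 / η / δ) ^ 2 * η * (harmonic h.length : ℝ)
        + h.length * (1 / η * (d₁ + d₂)) := by
  induction h with
  | nil => simp [regGame, estimateSum, payoff_zero, transcript, totalPayoff]
  | cons p h ih =>
    have hs : 0 < 1 / η := by positivity
    have hsad := hxy.isSaddlePointOn hη (transcript A h)
    have hsad' := hxy.isSaddlePointOn hη (transcript A (p :: h))
    rw [length_transcript] at hsad hsad'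
    rw [List.length_cons, Nat.cast_succ, add_mul, one_mul] at hsad'
    set os := transcript A h with hos
    have hos' : transcript A (p :: h) = (p.1, p.2, A h p.1 p.2) :: os := rfl
    have key := abs_regGame_value_sub_le hδ (by positivity : 0 ≤ 1 / δ ^ 2)
      (by positivity : 0 ≤ (h.length : ℝ) * (1 / η)) hs
      (abs_estimate_le hδ (hxy.mem_x os) (hxy.mem_y os)
        (o := (p.1, p.2, A h p.1 p.2)) (hA h p.1 p.2))
      (hxy.mem_x os) (hxy.mem_x (transcript A (p :: h))) (hxy.mem_y os)
      (hxy.mem_y (transcript A (p :: h))) hsad (by rw [hos'] at hsad' ⊢; exact hsad')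
    have hval : regGame (estimate (x os) (y os) (p.1, p.2, A h p.1 p.2)) (1 / η) (x os) (y os)
        = A h p.1 p.2 + 1 / η * (entropyReg (x os) - entropyReg (y os)) := by
      rw [regGame, payoff_estimate (hδ.trans_le ((hxy.mem_x os).2 _)).ne'
        (hδ.trans_le ((hxy.mem_y os).2 _)).ne']
    have hent : |1 / η * (entropyReg (x os) - entropyReg (y os))| ≤ 1 / η * (d₁ + d₂) := by
      rw [abs_mul, abs_of_pos hs]
      refine mul_le_mul_of_nonneg_left ?_ hs.le
      have h1 := entropyReg_nonneg (hxy.mem_x os).1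
      have h2 := entropyReg_nonneg (hxy.mem_y os).1
      have h3 := entropyReg_le (hxy.mem_x os).1
      have h4 := entropyReg_le (hxy.mem_y os).1
      rw [abs_le]; constructor <;> linarith
    -- The updated regularisation weight is (t + 1)/η, with t the number of past rounds, so each
    -- step contributes one term of the harmonic sum.
    have hharm : 8 * ((d₁ : ℝ) + d₂) * (1 / δ ^ 2 + 1 / η / δ) ^ 2 /
          (h.length * (1 / η) + 1 / η)
        = 8 * (d₁ + d₂) * (1 / δ ^ 2 + 1 / η / δ) ^ 2 * η * ((h.length : ℝ) + 1)⁻¹ := by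
      have : (h.length : ℝ) + 1 ≠ 0 := by positivity
      field_simp
    rw [hval, hharm] at key
    rw [List.length_cons, harmonic_succ, Nat.cast_succ, add_mul (h.length : ℝ) 1 (1 / η), one_mul,
      totalPayoff, hos', estimateSum]
    rw [hos'] at key
    push_cast
    rw [abs_le] at *
    constructor <;> linarith [key.1, key.2, ih.1, ih.2, hent.1, hent.2]

/-! ### The expectation over histories -/

theorem histProb_nonneg (hδ : 0 ≤ δ) (hxy : IsBanditOMGRFTL δ η x y) (A : Adversary d₁ d₂) :
    ∀ h, 0 ≤ histProb x y A h
  | [] => zero_le_one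
  | _ :: h => mul_nonneg (histProb_nonneg hδ hxy A h)
      (mul_nonneg (hδ.trans ((hxy.mem_x _).2 _)) (hδ.trans ((hxy.mem_y _).2 _)))

/-- This is the tower property: the head of the list is the latest round, sampled from strategies
determined by the tail. -/
theorem expectation_succ (x : List (Obs d₁ d₂) → Fin d₁ → ℝ) (y : List (Obs d₁ d₂) → Fin d₂ → ℝ)
    (A : Adversary d₁ d₂) (T : ℕ) (f : History d₁ d₂ → ℝ) :
    expectation x y A (T + 1) f = expectation x y A T fun h =>
      ∑ p : Fin d₁ × Fin d₂, x (transcript A h) p.1 * y (transcript A h) p.2 * f (p :: h) := by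
  unfold expectation
  rw [← (Fin.consEquiv fun _ : Fin (T + 1) => Fin d₁ × Fin d₂).sum_comp, Fintype.sum_prod_type,
    Finset.sum_comm]
  refine Finset.sum_congr rfl fun ω _ => ?_
  rw [Finset.mul_sum]
  refine Finset.sum_congr rfl fun p _ => ?_
  simp only [Fin.consEquiv, Equiv.coe_fn_mk, List.ofFn_cons, histProb]
  ring

theorem expectation_add (x : List (Obs d₁ d₂) → Fin d₁ → ℝ) (y : List (Obs d₁ d₂) → Fin d₂ → ℝ)
    (A : Adversary d₁ d₂) (T : ℕ) (f g : History d₁ d₂ → ℝ) :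
    expectation x y A T (fun h => f h + g h)
      = expectation x y A T f + expectation x y A T g := by
  simp only [expectation, mul_add, Finset.sum_add_distrib]

theorem expectation_const_mul (x : List (Obs d₁ d₂) → Fin d₁ → ℝ)
    (y : List (Obs d₁ d₂) → Fin d₂ → ℝ) (A : Adversary d₁ d₂) (T : ℕ) (c : ℝ)
    (f : History d₁ d₂ → ℝ) :
    expectation x y A T (fun h => c * f h) = c * expectation x y A T f := by
  simp only [expectation, Finset.mul_sum]
  exact Finset.sum_congr rfl fun _ _ => by ring

theorem expectation_sum {ι : Type*} (s : Finset ι) (x : List (Obs d₁ d₂) → Fin d₁ → ℝ)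
    (y : List (Obs d₁ d₂) → Fin d₂ → ℝ) (A : Adversary d₁ d₂) (T : ℕ)
    (f : ι → History d₁ d₂ → ℝ) :
    expectation x y A T (fun h => ∑ i ∈ s, f i h) = ∑ i ∈ s, expectation x y A T (f i) := by
  simp only [expectation, Finset.mul_sum]
  exact Finset.sum_comm

theorem sum_strategy (hxy : IsBanditOMGRFTL δ η x y) (os : List (Obs d₁ d₂)) :
    ∑ p : Fin d₁ × Fin d₂, x os p.1 * y os p.2 = 1 := by
  rw [Fintype.sum_prod_type, ← Finset.sum_mul_sum, (hxy.mem_x os).1.2, (hxy.mem_y os).1.2, one_mul]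

theorem expectation_const (hxy : IsBanditOMGRFTL δ η x y) (A : Adversary d₁ d₂) (T : ℕ) (c : ℝ) :
    expectation x y A T (fun _ => c) = c := by
  induction T with
  | zero => simp [expectation, histProb]
  | succ T ih =>
    rw [expectation_succ]
    simpa only [← Finset.sum_mul, sum_strategy hxy, one_mul] using ih

theorem expectation_mono (hδ : 0 ≤ δ) (hxy : IsBanditOMGRFTL δ η x y) (A : Adversary d₁ d₂)
    {T : ℕ} {f g : History d₁ d₂ → ℝ} (hfg : ∀ h, h.length = T → f h ≤ g h) :
    expectation x y A T f ≤ expectation x y A T g :=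
  Finset.sum_le_sum fun _ _ =>
    mul_le_mul_of_nonneg_left (hfg _ List.length_ofFn) (histProb_nonneg hδ hxy A _)

theorem abs_expectation_le (hδ : 0 ≤ δ) (hxy : IsBanditOMGRFTL δ η x y) (A : Adversary d₁ d₂)
    (T : ℕ) (f : History d₁ d₂ → ℝ) :
    |expectation x y A T f| ≤ expectation x y A T fun h => |f h| := by
  refine (Finset.abs_sum_le_sum_abs _ _).trans (le_of_eq (Finset.sum_congr rfl fun _ _ => ?_))
  rw [abs_mul, abs_of_nonneg (histProb_nonneg hδ hxy A _)]

/-! ### Second moment of the estimation error -/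

/-- The error of the cumulative importance-weighted estimate. -/
def estimateError (x : List (Obs d₁ d₂) → Fin d₁ → ℝ) (y : List (Obs d₁ d₂) → Fin d₂ → ℝ)
    (A : Adversary d₁ d₂) (h : History d₁ d₂) : Matrix (Fin d₁) (Fin d₂) ℝ :=
  estimateSum x y (transcript A h) - matrixSum A h

/-- Given the past, the estimate is unbiased, so the cross term with the old error e vanishes; its
second moment is M_ij²/(a_i b_j) ≤ 1/δ². -/
theorem sum_estimate_error_sq_le (hδ : 0 < δ) {a : Fin d₁ → ℝ} {b : Fin d₂ → ℝ}
    (ha : a ∈ restrictedSimplex d₁ δ) (hb : b ∈ restrictedSimplex d₂ δ)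
    {M : Matrix (Fin d₁) (Fin d₂) ℝ} (hM : ∀ i j, |M i j| ≤ 1) (e : ℝ) (i : Fin d₁)
    (j : Fin d₂) :
    ∑ p : Fin d₁ × Fin d₂,
        a p.1 * b p.2 * (e + estimate a b (p.1, p.2, M p.1 p.2) i j - M i j) ^ 2
      ≤ e ^ 2 + 1 / δ ^ 2 := by
  have hi : 0 < a i := hδ.trans_le (ha.2 i)
  have hj : 0 < b j := hδ.trans_le (hb.2 j)
  have h0 : ∑ p : Fin d₁ × Fin d₂, a p.1 * b p.2 = 1 := by
    rw [Fintype.sum_prod_type, ← Finset.sum_mul_sum, ha.1.2, hb.1.2, one_mul]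
  have hself : estimate a b (i, j, M i j) i j = M i j / (a i * b j) := by simp [estimate]
  have hother : ∀ p : Fin d₁ × Fin d₂, p ≠ (i, j) →
      estimate a b (p.1, p.2, M p.1 p.2) i j = 0 := by
    rintro ⟨i', j'⟩ hp
    have : ¬ (i' = i ∧ j' = j) := by rintro ⟨rfl, rfl⟩; exact hp rfl
    simp [estimate, this]
  have h1 : ∑ p : Fin d₁ × Fin d₂, a p.1 * b p.2 * estimate a b (p.1, p.2, M p.1 p.2) i j
      = M i j := by
    rw [Fintype.sum_eq_single (i, j) fun p hp => by rw [hother p hp, mul_zero], hself]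
    field_simp
  have h2 : ∑ p : Fin d₁ × Fin d₂, a p.1 * b p.2 * estimate a b (p.1, p.2, M p.1 p.2) i j ^ 2
      ≤ 1 / δ ^ 2 := by
    rw [Fintype.sum_eq_single (i, j) fun p hp => by rw [hother p hp]; ring, hself]
    have h3 : a i * b j * (M i j / (a i * b j)) ^ 2 = M i j ^ 2 / (a i * b j) := by field_simp
    rw [h3]
    refine div_le_div₀ zero_le_one ?_ (by positivity) ?_
    · rw [← sq_abs]; exact pow_le_one₀ (abs_nonneg _) (hM i j)
    · rw [sq]; exact mul_le_mul (ha.2 i) (hb.2 j) hδ.le hi.le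
  have hexp : ∑ p : Fin d₁ × Fin d₂,
        a p.1 * b p.2 * (e + estimate a b (p.1, p.2, M p.1 p.2) i j - M i j) ^ 2
      = (e - M i j) ^ 2 * ∑ p : Fin d₁ × Fin d₂, a p.1 * b p.2
        + 2 * (e - M i j) *
          ∑ p : Fin d₁ × Fin d₂, a p.1 * b p.2 * estimate a b (p.1, p.2, M p.1 p.2) i j
        + ∑ p : Fin d₁ × Fin d₂, a p.1 * b p.2 * estimate a b (p.1, p.2, M p.1 p.2) i j ^ 2 := by
    rw [Finset.mul_sum, Finset.mul_sum, ← Finset.sum_add_distrib, ← Finset.sum_add_distrib]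
    exact Finset.sum_congr rfl fun p _ => by ring
  rw [hexp, h0, h1]
  nlinarith [sq_nonneg (M i j)]

/-- Martingale increments are orthogonal, so their variances add. Adaptivity does no harm, since the
next matrix is fixed once the past actions are known. -/
theorem expectation_estimateError_sq_le (hδ : 0 < δ) (hxy : IsBanditOMGRFTL δ η x y)
    (hA : ∀ h i j, |A h i j| ≤ 1) (T : ℕ) (i : Fin d₁) (j : Fin d₂) :
    expectation x y A T (fun h => estimateError x y A h i j ^ 2) ≤ T * (1 / δ ^ 2) := by
  induction T with
  | zero => simp [expectation, estimateError, estimateSum, transcript, matrixSum]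
  | succ T ih =>
    rw [expectation_succ]
    refine (expectation_mono hδ.le hxy A (g := fun h =>
      estimateError x y A h i j ^ 2 + 1 / δ ^ 2) fun h _ => ?_).trans ?_
    · refine le_trans (le_of_eq ?_) (sum_estimate_error_sq_le hδ
        (hxy.mem_x (transcript A h)) (hxy.mem_y (transcript A h)) (hA h)
        (estimateError x y A h i j) i j)
      refine Finset.sum_congr rfl fun p _ => ?_
      simp only [estimateError, transcript, estimateSum, matrixSum, Matrix.sub_apply,
        Matrix.add_apply]
      ring
    · rw [expectation_add, expectation_const hxy]
      push_cast
      linarith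

theorem expectation_sum_estimateError_sq_le (hδ : 0 < δ) (hxy : IsBanditOMGRFTL δ η x y)
    (hA : ∀ h i j, |A h i j| ≤ 1) (T : ℕ) :
    expectation x y A T (fun h => ∑ i, ∑ j, estimateError x y A h i j ^ 2)
      ≤ d₁ * (d₂ * (T * (1 / δ ^ 2))) := by
  simp only [expectation_sum]
  refine (Finset.sum_le_sum fun i _ => Finset.sum_le_sum fun j _ =>
    expectation_estimateError_sq_le hδ hxy hA T i j).trans (le_of_eq ?_)
  simp

/-! ### The value of the cumulative game -/

theorem abs_matrixSum_le (hA : ∀ h i j, |A h i j| ≤ 1) (h : History d₁ d₂) (i : Fin d₁)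
    (j : Fin d₂) : |matrixSum A h i j| ≤ h.length := by
  induction h with
  | nil => simp [matrixSum]
  | cons p h ih =>
    rw [matrixSum, Matrix.add_apply, List.length_cons, Nat.cast_succ]
    exact (abs_add_le _ _).trans (add_le_add ih (hA h i j))

/-- The value of a matrix game differs from the payoff of a regularised, perturbed game at a saddle
point over restricted simplices by at most the total size of the changes. -/
theorem abs_gameValue_sub_regGame_le {c B K : ℝ} (hδ : 0 ≤ δ) (hd₁ : δ * d₁ ≤ 1)
    (hd₂ : δ * d₂ ≤ 1) (hc : 0 ≤ c) (hB : 0 ≤ B) {M N : Matrix (Fin d₁) (Fin d₂) ℝ}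
    (hM : ∀ i j, |M i j| ≤ B) (hNM : ∀ i j, |(N - M) i j| ≤ K) {a : Fin d₁ → ℝ}
    {b : Fin d₂ → ℝ} (ha : a ∈ restrictedSimplex d₁ δ) (hb : b ∈ restrictedSimplex d₂ δ)
    (h : IsSaddlePointOn (restrictedSimplex d₁ δ) (restrictedSimplex d₂ δ) (regGame N c) a b) :
    |gameValue M - regGame N c a b|
      ≤ K + c * (d₁ + d₂) + 2 * B * (δ * (d₁ + d₂)) := by
  have hbdd : ∀ a' : Fin d₁ → ℝ, BddAbove ((fun y => payoff M a' y) '' stdSimplex ℝ (Fin d₂)) :=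
    fun a' => ((isCompact_stdSimplex ℝ _).image (continuous_payoff_right M a')).bddAbove
  have hpert : ∀ {z : Fin d₁ → ℝ} {w : Fin d₂ → ℝ}, z ∈ stdSimplex ℝ (Fin d₁) →
      w ∈ stdSimplex ℝ (Fin d₂) → |payoff N z w - payoff M z w| ≤ K := by
    intro z w hz hw
    have := abs_payoff_le hNM z w
    rwa [payoff_sub, sum_abs_of_mem_stdSimplex hz, sum_abs_of_mem_stdSimplex hw, mul_one,
      mul_one] at this
  have hnear : ∀ {d : ℕ}, 0 ≤ 2 * B * (δ * d) := fun {d} => by positivity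
  have hc1 : 0 ≤ c * d₁ := by positivity
  have hc2 : 0 ≤ c * d₂ := by positivity
  -- The strategy a certifies an upper bound on the value, and b below certifies a lower one. Each
  -- opponent is first moved into the restricted simplex, then `M` is exchanged for `N`. No minimax
  -- theorem for `M` is needed.
  have hupper : ∀ y ∈ stdSimplex ℝ (Fin d₂),
      payoff M a y ≤ regGame N c a b + (K + c * d₂ + 2 * B * (δ * d₂)) := by
    intro y hy
    obtain ⟨w, hw, hyw⟩ := exists_restrictedSimplex_near hδ hd₂ hy
    have h1 := (abs_le.1 (abs_payoff_sub_right_le hM ha.1 y w)).2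
    have h2 := mul_le_mul_of_nonneg_left hyw hB
    have h3 := (abs_le.1 (hpert ha.1 hw.1)).1
    have h4 := h a ha w hw
    have h5 := mul_nonneg hc (entropyReg_nonneg ha.1)
    have h6 := mul_le_mul_of_nonneg_left (entropyReg_le hw.1) hc
    rw [regGame] at h4
    linarith
  have hlower : ∀ z ∈ stdSimplex ℝ (Fin d₁),
      regGame N c a b - (K + c * d₁ + 2 * B * (δ * d₁)) ≤ payoff M z b := by
    intro z hz
    obtain ⟨w, hw, hzw⟩ := exists_restrictedSimplex_near hδ hd₁ hz
    have h1 := (abs_le.1 (abs_payoff_sub_left_le hM z w hb.1)).1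
    have h2 := mul_le_mul_of_nonneg_left hzw hB
    have h3 := (abs_le.1 (hpert hw.1 hb.1)).2
    have h4 := h w hw b hb
    have h5 := mul_nonneg hc (entropyReg_nonneg hb.1)
    have h6 := mul_le_mul_of_nonneg_left (entropyReg_le hw.1) hc
    have h7 : regGame N c w b = payoff N w b + c * (entropyReg w - entropyReg b) := rfl
    rw [h7] at h4
    linarith
  have hlower' : ∀ v ∈ (fun x => sSup ((fun y => payoff M x y) '' stdSimplex ℝ (Fin d₂))) ''
      stdSimplex ℝ (Fin d₁), regGame N c a b - (K + c * d₁ + 2 * B * (δ * d₁)) ≤ v := by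
    rintro _ ⟨z, hz, rfl⟩
    exact (hlower z hz).trans (le_csSup (hbdd z) ⟨b, hb.1, rfl⟩)
  have hle : gameValue M ≤ regGame N c a b + (K + c * d₂ + 2 * B * (δ * d₂)) := by
    refine (csInf_le ⟨_, hlower'⟩ ⟨a, ha.1, rfl⟩).trans (csSup_le ⟨_, b, hb.1, rfl⟩ ?_)
    rintro _ ⟨y, hy, rfl⟩
    exact hupper y hy
  have hge : regGame N c a b - (K + c * d₁ + 2 * B * (δ * d₁)) ≤ gameValue M :=
    le_csInf ⟨_, a, ha.1, rfl⟩ hlower'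
  have e1 := hnear (d := d₁)
  have e2 := hnear (d := d₂)
  rw [abs_le]
  constructor <;> linarith

/-- The expected deviation of the total payoff from the value of the cumulative game, for
general parameters; `κ` balances the two terms that bound the estimation error. -/
theorem abs_expectation_totalPayoff_sub_gameValue_le {κ : ℝ} (hδ : 0 < δ) (hη : 0 < η)
    (hκ : 0 < κ) (hd₁ : δ * d₁ ≤ 1) (hd₂ : δ * d₂ ≤ 1) (hxy : IsBanditOMGRFTL δ η x y)
    (hA : ∀ h i j, |A h i j| ≤ 1) (T : ℕ) :
    |expectation x y A T (fun h => totalPayoff A h - gameValue (matrixSum A h))|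
      ≤ 8 * (d₁ + d₂) * (1 / δ ^ 2 + 1 / η / δ) ^ 2 * η * (harmonic T : ℝ)
        + 2 * (T * (1 / η * (d₁ + d₂))) + 2 * T * (δ * (d₁ + d₂)) + κ / 2
        + 1 / (2 * κ) * (d₁ * (d₂ * (T * (1 / δ ^ 2)))) := by
  -- The entropy cost is counted twice: once when the value is compared with the realised payoff,
  -- once when the regulariser is removed from the cumulative game.
  set E := 8 * (d₁ + d₂) * (1 / δ ^ 2 + 1 / η / δ) ^ 2 * η * (harmonic T : ℝ)
        + 2 * (T * (1 / η * (d₁ + d₂))) + 2 * T * (δ * (d₁ + d₂)) + κ / 2 with hE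
  have hpath : ∀ h : History d₁ d₂, h.length = T →
      |totalPayoff A h - gameValue (matrixSum A h)|
        ≤ E + 1 / (2 * κ) * ∑ i, ∑ j, estimateError x y A h i j ^ 2 := by
    rintro h rfl
    set Q := ∑ i, ∑ j, estimateError x y A h i j ^ 2 with hQ
    have hK : ∀ i j, |(estimateSum x y (transcript A h) - matrixSum A h) i j|
        ≤ κ / 2 + 1 / (2 * κ) * Q := by
      intro i j
      change |estimateError x y A h i j| ≤ _
      have h1 : |estimateError x y A h i j| ^ 2 ≤ Q := by
        rw [sq_abs]
        refine le_trans ?_ (Finset.single_le_sum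
          (f := fun i => ∑ j, estimateError x y A h i j ^ 2)
          (fun i _ => Finset.sum_nonneg fun j _ => sq_nonneg _) (Finset.mem_univ i))
        exact Finset.single_le_sum (f := fun j => estimateError x y A h i j ^ 2)
          (fun j _ => sq_nonneg _) (Finset.mem_univ j)
      -- The AM-GM bound |e| ≤ κ/2 + e²/(2κ) replaces a square root, so second moments suffice after
      -- taking expectations.
      have e : κ / 2 + 1 / (2 * κ) * Q = (κ ^ 2 + Q) / (2 * κ) := by field_simp
      rw [e, le_div_iff₀ (by positivity)]
      nlinarith [sq_nonneg (|estimateError x y A h i j| - κ)]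
    have hsad := hxy.isSaddlePointOn hη (transcript A h)
    rw [length_transcript] at hsad
    have hv := abs_gameValue_sub_regGame_le hδ.le hd₁ hd₂
      (by positivity : 0 ≤ (h.length : ℝ) * (1 / η)) (Nat.cast_nonneg _)
      (abs_matrixSum_le hA h) hK (hxy.mem_x _) (hxy.mem_y _) hsad
    have hr := abs_regGame_sub_totalPayoff_le hδ hη hxy hA h
    rw [abs_le] at *
    constructor <;> linarith [hv.1, hv.2, hr.1, hr.2]
  refine (abs_expectation_le hδ.le hxy A T _).trans
    ((expectation_mono hδ.le hxy A hpath).trans ?_)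
  rw [expectation_add, expectation_const hxy, expectation_const_mul]
  gcongr
  exact expectation_sum_estimateError_sq_le hδ hxy hA T

end Play

end BanditOMG

end

/-! ### Choice of the parameters -/

theorem theorem5p2 :
    ∃ C : ℝ, ∀ (d₁ d₂ T : ℕ) (δ η : ℝ),
      1 ≤ T → δ = 1 / (T : ℝ) ^ (1 / 6 : ℝ) → η = (T : ℝ) ^ (1 / 6 : ℝ) →
      δ < min (1 / (d₁ : ℝ)) (1 / (d₂ : ℝ)) →
      ∀ (x : List (BanditOMG.Obs d₁ d₂) → Fin d₁ → ℝ)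
        (y : List (BanditOMG.Obs d₁ d₂) → Fin d₂ → ℝ),
        BanditOMG.IsBanditOMGRFTL δ η x y →
        ∀ A : BanditOMG.Adversary d₁ d₂, (∀ h i j, A h i j ∈ Set.Icc (-1 : ℝ) 1) →
          |BanditOMG.expectation x y A T
              (fun h => BanditOMG.totalPayoff A h
                - BanditOMG.gameValue (BanditOMG.matrixSum A h))|
            ≤ C * ((d₁ : ℝ) + d₂) * Real.log T * (T : ℝ) ^ (5 / 6 : ℝ) := by
  -- The final sum is 36.75 + 32 log T in units of (d₁+d₂) u⁵; since 1 ≤ 2 log T, it is at most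
  -- 105.5 log T.
  refine ⟨106, fun d₁ d₂ T δ η hT hδ hη hd x y hxy A hA => ?_⟩
  have hT0 : (0 : ℝ) < T := by exact_mod_cast hT
  set u : ℝ := (T : ℝ) ^ (1 / 6 : ℝ) with hu
  have hu0 : 0 < u := Real.rpow_pos_of_pos hT0 _
  have hu1 : 1 ≤ u := Real.one_le_rpow (by exact_mod_cast hT) (by norm_num)
  have hu5 : (T : ℝ) ^ (5 / 6 : ℝ) = u ^ 5 := by
    rw [hu, ← Real.rpow_natCast, ← Real.rpow_mul hT0.le]; norm_num
  have hu6 : (T : ℝ) = u ^ 6 := by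
    rw [hu, ← Real.rpow_natCast, ← Real.rpow_mul hT0.le]; norm_num
  have hδ0 : 0 < δ := hδ ▸ by positivity
  have hpos : ∀ d : ℕ, δ < 1 / (d : ℝ) → (1 : ℝ) ≤ d ∧ (d : ℝ) < u := by
    intro d h
    have h0 : 0 < d := by
      rcases Nat.eq_zero_or_pos d with rfl | h0
      -- For d = 0 the convention 1/0 = 0 would force δ < 0.
      · simp only [Nat.cast_zero, div_zero] at h; linarith
      · exact h0
    refine ⟨by exact_mod_cast h0, ?_⟩
    rw [hδ, one_div_lt_one_div hu0 (by exact_mod_cast h0)] at h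
    exact h
  obtain ⟨h1d₁, hd₁u⟩ := hpos d₁ (hd.trans_le (min_le_left _ _))
  obtain ⟨h1d₂, hd₂u⟩ := hpos d₂ (hd.trans_le (min_le_right _ _))
  -- For T = 1 one has u = 1, contradicting 1 ≤ d₁ < u. So log T is bounded below and can absorb the
  -- terms without a logarithm.
  have hT2 : 2 ≤ T := by
    by_contra! h
    obtain rfl : T = 1 := by omega
    rw [Nat.cast_one, Real.one_rpow] at hu
    linarith
  have hlog : 1 / 2 ≤ Real.log T := by
    have h1 : Real.log 2 ≤ Real.log T := Real.log_le_log (by norm_num) (by exact_mod_cast hT2)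
    linarith [Real.log_two_gt_d9]
  have hdu : ∀ {d : ℝ}, d < u → δ * d ≤ 1 := by
    intro d h
    rw [hδ, one_div_mul_eq_div, div_le_one hu0]; exact h.le
  -- Taking κ = u⁵ puts κ/2 at the target order.
  have hmain := BanditOMG.abs_expectation_totalPayoff_sub_gameValue_le hδ0 (hη ▸ hu0)
    (pow_pos hu0 5) (hdu hd₁u) (hdu hd₂u) hxy (fun h i j => abs_le.2 (hA h i j)) T
  refine hmain.trans ?_
  have hharm := harmonic_le_one_add_log T
  rw [hu5]
  set l := Real.log T
  set H : ℝ := (harmonic T : ℝ)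
  set D : ℝ := (d₁ : ℝ) + d₂ with hD
  have hD2 : 2 ≤ D := by linarith
  have hη' : η = u := hη
  have e1 : 8 * D * (1 / δ ^ 2 + 1 / η / δ) ^ 2 * η ≤ 32 * (D * u ^ 5) := by
    have h1 : 1 / δ ^ 2 + 1 / η / δ = u ^ 2 + 1 := by
      rw [hδ, hη']; field_simp
    have h2 : (u ^ 2 + 1) ^ 2 ≤ (2 * u ^ 2) ^ 2 := by
      gcongr; nlinarith
    rw [h1, hη']
    calc 8 * D * (u ^ 2 + 1) ^ 2 * u ≤ 8 * D * (2 * u ^ 2) ^ 2 * u := by gcongr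
      _ = _ := by ring
  have e2 : 2 * ((T : ℝ) * (1 / η * D)) = 2 * (D * u ^ 5) := by
    rw [hη', hu6]; field_simp
  have e3 : 2 * (T : ℝ) * (δ * D) = 2 * (D * u ^ 5) := by
    rw [hδ, hu6]; field_simp
  have e4 : u ^ 5 / 2 ≤ D * u ^ 5 / 4 := by
    have := mul_le_mul_of_nonneg_right hD2 (pow_pos hu0 5).le
    linarith
  have e5 : 1 / (2 * u ^ 5) * (d₁ * (d₂ * (T * (1 / δ ^ 2)))) ≤ D * u ^ 5 / 2 := by
    have h1 : 1 / (2 * u ^ 5) * (d₁ * (d₂ * (T * (1 / δ ^ 2)))) = d₁ * d₂ * u ^ 3 / 2 := by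
      rw [hδ, hu6]; field_simp
    -- The constraint d₁ < u turns the product of the dimensions into their sum at the cost of one
    -- factor u, for which there is room.
    have h2 : (d₁ : ℝ) * d₂ ≤ u * D := by
      calc (d₁ : ℝ) * d₂ ≤ u * d₂ := by gcongr
        _ ≤ u * D := by gcongr; linarith
    rw [h1]
    have h3 : (d₁ : ℝ) * d₂ * u ^ 3 ≤ u * D * u ^ 3 := by gcongr
    have h4 : u ^ 4 ≤ u ^ 5 := pow_le_pow_right₀ hu1 (by norm_num)
    have h5 : u * D * u ^ 3 ≤ D * u ^ 5 := by
      calc u * D * u ^ 3 = D * u ^ 4 := by ring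
        _ ≤ _ := by gcongr
    linarith
  have hDu : 0 < D * u ^ 5 := by positivity
  have hH0 : 0 ≤ H := by
    have : (0 : ℚ) ≤ harmonic T := Finset.sum_nonneg fun _ _ => by positivity
    exact Rat.cast_nonneg.2 this
  have e6 : 8 * D * (1 / δ ^ 2 + 1 / η / δ) ^ 2 * η * H ≤ 32 * (D * u ^ 5) * (1 + l) :=
    (mul_le_mul_of_nonneg_right e1 hH0).trans
      (mul_le_mul_of_nonneg_left hharm (by positivity))
  have e7 : D * u ^ 5 ≤ 2 * (D * u ^ 5 * l) := by nlinarith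
  calc _ ≤ 32 * (D * u ^ 5) * (1 + l) + 2 * (D * u ^ 5) + 2 * (D * u ^ 5) + D * u ^ 5 / 4
        + D * u ^ 5 / 2 := by linarith
    _ ≤ 106 * (D * u ^ 5 * l) := by linarith
    _ = 106 * D * l * u ^ 5 := by ring
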